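/- Let $M$ be a finite matroid of rank $r$ on a ground set $E$. A *presentation* of $M$ is a sequence $\mathcal{A}=(A_1,\ldots,A_r)$ of exactly $r$ subsets of $E$ such that the independent sets of $M$ are precisely the partial transversals of $\mathcal{A}$ (the sets $X\subseteq E$ that admit an injection $\phi:X\to\{1,\ldots,r\}$ with $e\in A_{\phi(e)}$ for all $e\in X$); in this case we write $M=M[\mathcal{A}]$. Fix $x\notin E$. For $I\subseteq\{1,\ldots,r\}$ let $\mathcal{A}^I$ be the sequence on $E\cup\{x\}$ obtained from $\mathcal{A}$ by adjoining $x$ to the sets $A_i$ with $i\in I$, and let $T_{\mathcal{A}}=\{M[\mathcal{A}^I] : I\subseteq\{1,\ldots,r\}\}$, a set of matroids on $E\cup\{x\}$. **Theorem.** If $\mathcal{A}=(A_1,\ldots,A_r)$ and $\mathcal{B}=(B_1,\ldots,B_r)$ are presentations of $M$ that differ by more than reindexing, that is, there is no permutation $\tau$ of $\{1,\ldots,r\}$ with $B_i=A_{\tau(i)}$ for all $i$, then $$|T_{\mathcal{A}}\cap T_{\mathcal{B}}|\le \tfrac34\cdot 2^r.$$ This bound is sharp: for every $r\ge 2$, the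 rank-$r$ matroid $U_{r-2,r-2}\oplus U_{2,3}$ (where $U_{k,n}$ is the uniform matroid of rank $k$ on $n$ elements) has presentations $\mathcal{A}$ and $\mathcal{B}$ that differ by more than reindexing and satisfy $|T_{\mathcal{A}}\cap T_{\mathcal{B}}|=\tfrac34\cdot 2^r$. -/

import Mathlib

/-- `X` is a partial transversal of the set system `A`: there is an injection `φ` from `X` into the
index set with `e ∈ A (φ e)` for all `e ∈ X`. -/
def IsPartialTransversal {α : Type*} {r : ℕ} (A : Fin r → Set α) (X : Set α) : Prop :=
  ∃ φ : X → Fin r, Function.Injective φ ∧ ∀ e : X, (e : α) ∈ A (φ e)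

open Classical in
/-- The support of a set `Z` with respect to a set system `A`: the indices of the sets
that meet `Z`. -/
noncomputable def setSystemSupport {α : Type*} {r : ℕ} (A : Fin r → Set α) (Z : Finset α) :
    Finset (Fin r) :=
  Finset.univ.filter fun i => ∃ e ∈ Z, e ∈ A i

theorem mem_setSystemSupport {α : Type*} {r : ℕ} {A : Fin r → Set α} {Z : Finset α} {i : Fin r} :
    i ∈ setSystemSupport A Z ↔ ∃ e ∈ Z, e ∈ A i := by
  simp [setSystemSupport]

theorem isPartialTransversal_iff_hall {α : Type*} {r : ℕ} (A : Fin r → Set α) (X : Set α) :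
    IsPartialTransversal A X ↔
      ∀ Z : Finset α, (Z : Set α) ⊆ X → Z.card ≤ (setSystemSupport A Z).card := by
  classical
  let t : X → Finset (Fin r) := fun e => Finset.univ.filter fun i => (e : α) ∈ A i
  have h1 := Finset.all_card_le_biUnion_card_iff_exists_injective t
  have h2 : IsPartialTransversal A X ↔ ∀ s : Finset X, s.card ≤ (s.biUnion t).card := by
    rw [h1]
    simp [IsPartialTransversal, t]
  rw [h2]
  constructor
  · intro h Z hZ
    have h3 := h (Z.subtype (· ∈ X))
    rw [Finset.card_subtype, Finset.filter_true_of_mem (fun e he => hZ he)] at h3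
    refine h3.trans (Finset.card_le_card ?_)
    intro i hi
    simp only [Finset.mem_biUnion, Finset.mem_subtype, t, Finset.mem_filter] at hi
    obtain ⟨e, he, -, hi⟩ := hi
    exact mem_setSystemSupport.2 ⟨e, he, hi⟩
  · intro h s
    have h3 := h (s.map (Function.Embedding.subtype _)) (by
      intro e he
      simp only [Finset.coe_map, Function.Embedding.subtype_apply, Set.mem_image] at he
      obtain ⟨a, -, rfl⟩ := he
      exact a.2)
    rw [Finset.card_map] at h3
    refine h3.trans (Finset.card_le_card ?_)
    intro i hi
    obtain ⟨e, he, hi⟩ := mem_setSystemSupport.1 hi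
    simp only [Finset.mem_map, Function.Embedding.subtype_apply] at he
    obtain ⟨a, ha, rfl⟩ := he
    simp only [Finset.mem_biUnion, t, Finset.mem_filter]
    exact ⟨a, ha, Finset.mem_univ _, hi⟩

theorem setSystemSupport_union {α : Type*} [DecidableEq α] {r : ℕ} (A : Fin r → Set α)
    (Y Z : Finset α) :
    setSystemSupport A (Y ∪ Z) = setSystemSupport A Y ∪ setSystemSupport A Z := by
  ext i
  simp only [mem_setSystemSupport, Finset.mem_union, or_and_right, exists_or]

theorem setSystemSupport_mono {α : Type*} {r : ℕ} (A : Fin r → Set α) {Y Z : Finset α}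
    (h : Y ⊆ Z) : setSystemSupport A Y ⊆ setSystemSupport A Z := by
  intro i hi
  obtain ⟨e, he, hi⟩ := mem_setSystemSupport.1 hi
  exact mem_setSystemSupport.2 ⟨e, h he, hi⟩

theorem IsPartialTransversal.subset {α : Type*} {r : ℕ} {A : Fin r → Set α} {X Y : Set α}
    (hY : IsPartialTransversal A Y) (h : X ⊆ Y) : IsPartialTransversal A X := by
  rw [isPartialTransversal_iff_hall] at hY ⊢
  exact fun Z hZ => hY Z (hZ.trans h)

theorem IsPartialTransversal.encard_le {α : Type*} {r : ℕ} {A : Fin r → Set α} {X : Set α}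
    (hX : IsPartialTransversal A X) : X.encard ≤ r := by
  obtain ⟨φ, hφ, -⟩ := hX
  calc X.encard = ENat.card X := by rw [ENat.card_coe_set_eq]
    _ ≤ ENat.card (Fin r) := ENat.card_le_card_of_injective hφ
    _ = r := by simp

theorem IsPartialTransversal.augment {α : Type*} {r : ℕ} {A : Fin r → Set α} {I J : Set α}
    (hI : IsPartialTransversal A I) (hJ : IsPartialTransversal A J)
    (hIJ : I.encard < J.encard) :
    ∃ e ∈ J, e ∉ I ∧ IsPartialTransversal A (insert e I) := by
  classical
  have hIf : I.Finite := Set.finite_of_encard_le_coe hI.encard_le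
  have hJf : J.Finite := Set.finite_of_encard_le_coe hJ.encard_le
  lift I to Finset α using hIf
  lift J to Finset α using hJf
  rw [Set.encard_coe_eq_coe_finsetCard, Set.encard_coe_eq_coe_finsetCard, Nat.cast_lt] at hIJ
  by_contra! hcon
  -- every element of `J \ I` has its support inside the support of a tight subset of `I`
  have key : ∀ e ∈ J \ I, ∃ Y ⊆ I, (setSystemSupport A Y).card = Y.card ∧
      setSystemSupport A {e} ⊆ setSystemSupport A Y := by
    intro e he
    rw [Finset.mem_sdiff] at he
    have h := hcon e he.1 he.2
    rw [isPartialTransversal_iff_hall] at h hI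
    push Not at h
    obtain ⟨Z, hZ, hlt⟩ := h
    have hZI : Z.erase e ⊆ I := by
      intro a ha
      rw [Finset.mem_erase] at ha
      exact (hZ ha.2).resolve_left ha.1
    have heZ : e ∈ Z := by
      by_contra h
      rw [Finset.erase_eq_of_notMem h] at hZI
      exact absurd (hI Z (by exact_mod_cast hZI)) (not_le.2 hlt)
    have h1 := hI (Z.erase e) (by exact_mod_cast hZI)
    have h2 := Finset.card_le_card (setSystemSupport_mono A (Finset.erase_subset e Z))
    have h3 := Finset.card_erase_add_one heZ
    have h4 : setSystemSupport A (Z.erase e) = setSystemSupport A Z :=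
      Finset.eq_of_subset_of_card_le (setSystemSupport_mono A (Finset.erase_subset e Z)) (by omega)
    refine ⟨Z.erase e, hZI, by omega, ?_⟩
    rw [h4]
    exact setSystemSupport_mono A (by simpa using heZ)
  -- tight sets are closed under union
  have union : ∀ D : Finset α, D ⊆ J \ I → ∃ Y ⊆ I, (setSystemSupport A Y).card = Y.card ∧
      setSystemSupport A D ⊆ setSystemSupport A Y := by
    intro D
    induction D using Finset.induction_on with
    | empty =>
      intro _
      refine ⟨∅, by simp, ?_, by simp⟩
      simp [setSystemSupport]
    | insert e D _ ih =>
      intro hD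
      obtain ⟨Y, hY, hYc, hYs⟩ := ih ((Finset.subset_insert e D).trans hD)
      obtain ⟨Z, hZ, hZc, hZs⟩ := key e (hD (Finset.mem_insert_self e D))
      refine ⟨Y ∪ Z, Finset.union_subset hY hZ, ?_, ?_⟩
      · rw [isPartialTransversal_iff_hall] at hI
        have h1 := hI (Y ∪ Z) (by exact_mod_cast Finset.union_subset hY hZ)
        have h2 := hI (Y ∩ Z) (by exact_mod_cast Finset.inter_subset_left.trans hY)
        have h3 := Finset.card_union_add_card_inter Y Z
        have h4 := Finset.card_union_add_card_inter (setSystemSupport A Y) (setSystemSupport A Z)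
        have h5 : (setSystemSupport A (Y ∩ Z)).card ≤
            (setSystemSupport A Y ∩ setSystemSupport A Z).card :=
          Finset.card_le_card (Finset.subset_inter
            (setSystemSupport_mono A Finset.inter_subset_left)
            (setSystemSupport_mono A Finset.inter_subset_right))
        rw [setSystemSupport_union] at h1 ⊢
        omega
      · rw [Finset.insert_eq, setSystemSupport_union, setSystemSupport_union]
        exact Finset.union_subset (hZs.trans Finset.subset_union_right)
          (hYs.trans Finset.subset_union_left)
  obtain ⟨Y, hY, hYc, hYs⟩ := union (J \ I) subset_rfl
  rw [isPartialTransversal_iff_hall] at hJ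
  have h1 := hJ ((J ∩ Y) ∪ (J \ I)) (by
    exact_mod_cast Finset.union_subset Finset.inter_subset_left Finset.sdiff_subset)
  have h2 : (setSystemSupport A ((J ∩ Y) ∪ (J \ I))).card ≤ Y.card := by
    rw [← hYc, setSystemSupport_union]
    exact Finset.card_le_card (Finset.union_subset
      (setSystemSupport_mono A Finset.inter_subset_right) hYs)
  have h3 : Disjoint (J ∩ Y) (J \ I) := by
    rw [Finset.disjoint_left]
    intro a ha hb
    exact (Finset.mem_sdiff.1 hb).2 (hY (Finset.mem_inter.1 ha).2)
  rw [Finset.card_union_of_disjoint h3] at h1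
  have h4 : Y.card ≤ (J ∩ Y).card + (I \ J).card := by
    rw [← Finset.card_inter_add_card_sdiff Y J, Finset.inter_comm]
    exact Nat.add_le_add_left (Finset.card_le_card (Finset.sdiff_subset_sdiff hY subset_rfl)) _
  have h5 := Finset.card_inter_add_card_sdiff J I
  have h6 := Finset.card_inter_add_card_sdiff I J
  rw [Finset.inter_comm] at h6
  omega

/-- The transversal matroid `M[A]` on the ground set `E`: its independent sets are the partial
transversals of `A` that are contained in `E`. -/
def transversalMatroid {α : Type*} {r : ℕ} (E : Set α) (A : Fin r → Set α) : Matroid α :=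
  (IndepMatroid.ofBddAugment E (fun X => X ⊆ E ∧ IsPartialTransversal A X)
    ⟨Set.empty_subset E, fun e => e.2.elim, fun e => e.2.elim, fun e => e.2.elim⟩
    (fun _ _ hJ h => ⟨h.trans hJ.1, hJ.2.subset h⟩)
    (fun _ _ hI hJ hlt => by
      obtain ⟨e, heJ, heI, he⟩ := hI.2.augment hJ.2 hlt
      exact ⟨e, heJ, heI, Set.insert_subset (hJ.1 heJ) hI.1, he⟩)
    ⟨r, fun _ hI => hI.2.encard_le⟩
    (fun _ hI => hI.1)).matroid

theorem transversalMatroid_ground {α : Type*} {r : ℕ} (E : Set α) (A : Fin r → Set α) :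
    (transversalMatroid E A).E = E := rfl

theorem transversalMatroid_indep_iff {α : Type*} {r : ℕ} {E : Set α} {A : Fin r → Set α}
    {X : Set α} : (transversalMatroid E A).Indep X ↔ X ⊆ E ∧ IsPartialTransversal A X := Iff.rfl

/-- `A = (A i : i ∈ Fin r)` is a presentation of `M`, with as many sets as the rank of `M`. -/
structure IsPresentation {α : Type*} {r : ℕ} (M : Matroid α) (A : Fin r → Set α) : Prop where
  rank_eq : M.eRank = r
  subset_ground : ∀ i, A i ⊆ M.E
  eq_transversalMatroid : transversalMatroid M.E A = M

/-- The set system obtained from `A` by adjoining `x` to the sets indexed by `I`. -/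
def extendSystem {α : Type*} {r : ℕ} (A : Fin r → Set α) (x : α) (I : Set (Fin r)) :
    Fin r → Set α :=
  fun i => {e | e ∈ A i ∨ (e = x ∧ i ∈ I)}

/-- The set of single-element extensions `M[A^I]` of `M` on `M.E ∪ {x}` that have presentations
extending `A`. -/
def transversalExtensions {α : Type*} {r : ℕ} (M : Matroid α) (A : Fin r → Set α) (x : α) :
    Set (Matroid α) :=
  Set.range fun I : Set (Fin r) => transversalMatroid (insert x M.E) (extendSystem A x I)

theorem transversalExtensions_finite {α : Type*} {r : ℕ} (M : Matroid α) (A : Fin r → Set α)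
    (x : α) : (transversalExtensions M A x).Finite :=
  Set.finite_range _

/-- `A` and `B` differ only by a reindexing of their sets. -/
def IsReindexing {α : Type*} {r : ℕ} (A B : Fin r → Set α) : Prop :=
  ∃ τ : Equiv.Perm (Fin r), ∀ i, B i = A (τ i)

/-- The uniform matroid of rank `min k |E|` on `E`: its independent sets are the subsets of `E`
with at most `k` elements. -/
def uniformMatroid {α : Type*} (E : Set α) (k : ℕ) : Matroid α :=
  (IndepMatroid.ofBddAugment E (fun X => X ⊆ E ∧ X.encard ≤ k)
    ⟨Set.empty_subset E, by simp⟩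
    (fun _ _ hJ h => ⟨h.trans hJ.1, (Set.encard_le_encard h).trans hJ.2⟩)
    (fun I J hI hJ hlt => by
      obtain ⟨e, heJ, heI⟩ := Set.not_subset.1 fun h : J ⊆ I =>
        absurd (Set.encard_le_encard h) (not_le.2 hlt)
      exact ⟨e, heJ, heI, Set.insert_subset (hJ.1 heJ) hI.1, by
        rw [Set.encard_insert_of_notMem heI]
        exact (Order.add_one_le_of_lt hlt).trans hJ.2⟩)
    ⟨k, fun _ hI => hI.2⟩
    (fun _ hI => hI.1)).matroid

theorem uniformMatroid_ground {α : Type*} (E : Set α) (k : ℕ) : (uniformMatroid E k).E = E := rfl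

/-! Call an index set T tight if |T| distinct elements represent it and lie in no set indexed
outside T. By Hall, for independent Z, the set Z ∪ {x} is dependent in M[A^I] exactly when I lies in
a tight set represented inside Z. Tight sets are closed under union.

If some {j}ᶜ is not tight in B, there is i ≠ j such that every tight set containing i contains j.
Adjoining j to an I containing i then changes nothing, so three quarters of the sets I already give
every extension of B.

Otherwise the B_i are distinct and some B_k is no A_j. Let Z be the r-1 representatives of {k}ᶜ in
B. A common extension in which Z ∪ {x} is independent has k in its B-index set: at most 2^(r-1)
cases. In any other, the A-index set lies in the greatest A-tight T represented inside Z. Here |T| ≤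
r-2, since a tight {j}ᶜ represented by Z would force A_j = B_k: at most 2^(r-2) cases.

For sharpness, two presentations differ by exchanging two elements of the triangle. They give the
same extension for every I with p ∈ I → q ∈ I, and distinct I give distinct extensions. -/

/-! ### Tight index sets -/

/-- `y` restricted to `T` picks distinct representatives of the sets `A t` with `t ∈ T`, and
these representatives lie in no set of `A` with an index outside `T`. -/
structure IsTightSystem {α : Type*} {r : ℕ} (A : Fin r → Set α) (T : Set (Fin r))
    (y : Fin r → α) : Prop where
  injOn : Set.InjOn y T
  mem : ∀ t ∈ T, y t ∈ A t
  support : ∀ t ∈ T, ∀ i, y t ∈ A i → i ∈ T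

theorem isPartialTransversal_image {α : Type*} {r : ℕ} {A : Fin r → Set α} {T : Set (Fin r)}
    {y : Fin r → α} (hA : ∀ t ∈ T, y t ∈ A t) :
    IsPartialTransversal A (y '' T) := by
  have h : ∀ e : y '' T, ∃ t ∈ T, y t = e := fun e => e.2
  choose φ hT hφ using h
  refine ⟨φ, fun e f hef => Subtype.ext ?_, fun e => ?_⟩
  · rw [← hφ e, ← hφ f, hef]
  · have := hA _ (hT e)
    rwa [hφ e] at this

theorem IsPartialTransversal.encard_le_of_support {α : Type*} {r : ℕ} {A : Fin r → Set α}
    {X : Set α} {T : Set (Fin r)} (hX : IsPartialTransversal A X)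
    (hT : ∀ e ∈ X, ∀ i, e ∈ A i → i ∈ T) : X.encard ≤ T.encard := by
  obtain ⟨φ, hφ, hA⟩ := hX
  let ψ : X → T := fun e => ⟨φ e, hT e e.2 _ (hA e)⟩
  have hψ : Function.Injective ψ := fun e f h => hφ (congrArg Subtype.val h)
  have := ENat.card_le_card_of_injective hψ
  rwa [ENat.card_coe_set_eq, ENat.card_coe_set_eq] at this

/-- Keep `y` on `T` and use `w` on the rest of `U`. No clash occurs: `w u` lies in `A u` with `u ∉
T`, so it is not a representative of `T`. -/
theorem IsTightSystem.union {α : Type*} {r : ℕ} {A : Fin r → Set α} {T U : Set (Fin r)}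
    {y w : Fin r → α} (hT : IsTightSystem A T y) (hU : IsTightSystem A U w) :
    ∃ v, IsTightSystem A (T ∪ U) v ∧ v '' (T ∪ U) ⊆ y '' T ∪ w '' U := by
  classical
  have hv : ∀ t ∈ T ∪ U, (t ∈ T ∧ T.piecewise y w t = y t) ∨
      (t ∉ T ∧ t ∈ U ∧ T.piecewise y w t = w t) := by
    intro t ht
    by_cases h : t ∈ T
    · exact Or.inl ⟨h, Set.piecewise_eq_of_mem _ _ _ h⟩
    · exact Or.inr ⟨h, ht.resolve_left h, Set.piecewise_eq_of_notMem _ _ _ h⟩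
  refine ⟨T.piecewise y w, ⟨?_, ?_, ?_⟩, ?_⟩
  · intro s hs t ht hst
    rcases hv s hs with ⟨hs1, hs2⟩ | ⟨hs1, hs2, hs3⟩ <;>
      rcases hv t ht with ⟨ht1, ht2⟩ | ⟨ht1, ht2, ht3⟩
    · exact hT.injOn hs1 ht1 (by rw [← hs2, ← ht2, hst])
    · refine absurd (hT.support s hs1 t ?_) ht1
      rw [← hs2, hst, ht3]
      exact hU.mem t ht2
    · refine absurd (hT.support t ht1 s ?_) hs1
      rw [← ht2, ← hst, hs3]
      exact hU.mem s hs2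
    · exact hU.injOn hs2 ht2 (by rw [← hs3, ← ht3, hst])
  · intro t ht
    rcases hv t ht with ⟨h1, h2⟩ | ⟨-, h1, h2⟩ <;> rw [h2]
    · exact hT.mem t h1
    · exact hU.mem t h1
  · intro t ht i hi
    rcases hv t ht with ⟨h1, h2⟩ | ⟨-, h1, h2⟩ <;> rw [h2] at hi
    · exact Or.inl (hT.support t h1 i hi)
    · exact Or.inr (hU.support t h1 i hi)
  · rintro _ ⟨t, ht, rfl⟩
    rcases hv t ht with ⟨h1, h2⟩ | ⟨-, h1, h2⟩ <;> rw [h2]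
    · exact Or.inl ⟨t, h1, rfl⟩
    · exact Or.inr ⟨t, h1, rfl⟩

/-- Among the tight systems with representatives in `Z` and indices in `J`, there is one with
greatest index set. -/
theorem exists_greatest_isTightSystem {α : Type*} [Nonempty α] {r : ℕ} (A : Fin r → Set α)
    (Z : Set α) (J : Set (Fin r)) :
    ∃ T y, IsTightSystem A T y ∧ y '' T ⊆ Z ∧ T ⊆ J ∧
      ∀ U w, IsTightSystem A U w → w '' U ⊆ Z → U ⊆ J → U ⊆ T := by
  let 𝒯 : Set (Set (Fin r)) := {T | T ⊆ J ∧ ∃ y, IsTightSystem A T y ∧ y '' T ⊆ Z}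
  have hne : 𝒯.Nonempty := ⟨∅, Set.empty_subset _, fun _ => Classical.arbitrary α,
    ⟨by simp, by simp, by simp⟩, by simp⟩
  obtain ⟨T, ⟨hTJ, y, hy, hyZ⟩, hmax⟩ := (Set.toFinite 𝒯).exists_maximal hne
  refine ⟨T, y, hy, hyZ, hTJ, fun U w hw hwZ hUJ => ?_⟩
  obtain ⟨v, hv, hvZ⟩ := hy.union hw
  exact Set.subset_union_right.trans (hmax ⟨Set.union_subset hTJ hUJ, v, hv,
    hvZ.trans (Set.union_subset hyZ hwZ)⟩ Set.subset_union_left)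

/-- An element of `A j` can be matched to the free index `j`; any other would leave r elements
competing for r-1 indices. So `A j` depends only on the matroid and the set of representatives,
which allows comparison of sets from different presentations. -/
theorem IsTightSystem.mem_iff {α : Type*} {r : ℕ} {A : Fin r → Set α} {j : Fin r}
    {y : Fin r → α} (hy : IsTightSystem A {j}ᶜ y) (e : α) :
    e ∈ A j ↔ e ∉ y '' {j}ᶜ ∧ IsPartialTransversal A (insert e (y '' {j}ᶜ)) := by
  classical
  constructor
  · intro he
    have h1 : e ∉ y '' {j}ᶜ := by
      rintro ⟨t, ht, rfl⟩
      exact hy.support t ht j he rfl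
    refine ⟨h1, ?_⟩
    have hne : ∀ t, t ≠ j → Function.update y j e t = y t := fun t ht =>
      Function.update_of_ne ht _ _
    refine (isPartialTransversal_image (T := Set.univ) (y := Function.update y j e)
      ?_).subset ?_
    · intro t _
      by_cases ht : t = j
      · subst ht
        rwa [Function.update_self]
      · rw [hne t ht]
        exact hy.mem t ht
    · rintro f (rfl | ⟨t, ht, rfl⟩)
      · exact ⟨j, trivial, Function.update_self _ _ _⟩
      · exact ⟨t, trivial, hne t ht⟩
  · rintro ⟨h1, h2⟩
    by_contra he
    have h3 := h2.encard_le_of_support (T := {j}ᶜ) (by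
      rintro f (rfl | ⟨t, ht, rfl⟩) i hi
      · rintro rfl
        exact he hi
      · exact hy.support t ht i hi)
    rw [Set.encard_insert_of_notMem h1, hy.injOn.encard_image] at h3
    exact absurd h3 (not_le.2 ((ENat.lt_add_one_iff (Set.toFinite _).encard_lt_top.ne).2 le_rfl))

theorem IsTightSystem.extend {α : Type*} {r : ℕ} {A : Fin r → Set α} {x : α}
    (hx : ∀ i, x ∉ A i) {T : Set (Fin r)} {y : Fin r → α} (hy : IsTightSystem A T y)
    (I : Set (Fin r)) : IsTightSystem (extendSystem A x I) T y := by
  refine ⟨hy.injOn, fun t ht => Or.inl (hy.mem t ht), fun t ht i hi => ?_⟩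
  rcases hi with hi | ⟨h, -⟩
  · exact hy.support t ht i hi
  · exact absurd (h ▸ hy.mem t ht) (hx t)

/-- This is `mem_iff` for the element `x` of the extended system: the extension matroid remembers
whether `j` was in `I`. -/
theorem IsTightSystem.extendSystem_mem_iff {α : Type*} {r : ℕ} {A : Fin r → Set α} {x : α}
    (hx : ∀ i, x ∉ A i) {j : Fin r} {y : Fin r → α} (hy : IsTightSystem A {j}ᶜ y)
    (I : Set (Fin r)) :
    j ∈ I ↔ IsPartialTransversal (extendSystem A x I) (insert x (y '' {j}ᶜ)) := by
  have h := (hy.extend hx I).mem_iff x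
  have h1 : x ∉ y '' {j}ᶜ := by
    rintro ⟨t, ht, rfl⟩
    exact hx t (hy.mem t ht)
  have h2 : x ∈ extendSystem A x I j ↔ j ∈ I := by
    simp [extendSystem, hx j]
  rw [← h2, h, and_iff_right h1]

/-! ### Dependence in an extension -/

theorem isPartialTransversal_extendSystem_of_notMem {α : Type*} {r : ℕ} {A : Fin r → Set α}
    {x : α} {I : Set (Fin r)} {X : Set α} (hX : x ∉ X) :
    IsPartialTransversal (extendSystem A x I) X ↔ IsPartialTransversal A X := by
  refine exists_congr fun φ => and_congr_right fun _ => forall_congr' fun e => ?_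
  refine or_iff_left ?_
  rintro ⟨h, -⟩
  exact hX (h ▸ e.2)

theorem extendSystem_mono {α : Type*} {r : ℕ} (A : Fin r → Set α) (x : α) {I J : Set (Fin r)}
    (h : I ⊆ J) (i : Fin r) : extendSystem A x I i ⊆ extendSystem A x J i :=
  fun _ he => he.imp_right fun h1 => ⟨h1.1, h h1.2⟩

theorem IsPartialTransversal.mono {α : Type*} {r : ℕ} {A B : Fin r → Set α} {X : Set α}
    (hX : IsPartialTransversal A X) (h : ∀ i, A i ⊆ B i) : IsPartialTransversal B X := by
  obtain ⟨φ, hφ, hA⟩ := hX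
  exact ⟨φ, hφ, fun e => h _ (hA e)⟩

/-- By cardinality a matching of `Y` is a bijection onto its support; its inverse gives the
representatives. -/
theorem exists_isTightSystem_of_card_eq {α : Type*} {r : ℕ} {A : Fin r → Set α} {Y : Finset α}
    [Nonempty α] (hY : IsPartialTransversal A Y) (hc : (setSystemSupport A Y).card = Y.card) :
    ∃ y, IsTightSystem A (setSystemSupport A Y) y ∧ y '' (setSystemSupport A Y) ⊆ Y := by
  obtain ⟨φ, hφ, hA⟩ := hY
  have hmaps : ∀ e : (Y : Set α), φ e ∈ setSystemSupport A Y := fun e =>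
    mem_setSystemSupport.2 ⟨e, e.2, hA e⟩
  have hsurj : ∀ t ∈ setSystemSupport A Y, ∃ e : (Y : Set α), φ e = t := by
    have h1 : (Finset.univ.map ⟨φ, hφ⟩ : Finset (Fin r)) = setSystemSupport A Y := by
      refine Finset.eq_of_subset_of_card_le (fun t ht => ?_) ?_
      · obtain ⟨e, -, rfl⟩ := Finset.mem_map.1 ht
        exact hmaps e
      · rw [hc, Finset.card_map]
        simp
    intro t ht
    rw [← h1] at ht
    obtain ⟨e, -, he⟩ := Finset.mem_map.1 ht
    exact ⟨e, he⟩
  have hsurj' : ∀ t, ∃ e : α, t ∈ setSystemSupport A Y → ∃ h : e ∈ (Y : Set α), φ ⟨e, h⟩ = t := by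
    intro t
    by_cases ht : t ∈ setSystemSupport A Y
    · obtain ⟨e, he⟩ := hsurj t ht
      exact ⟨e, fun _ => ⟨e.2, he⟩⟩
    · exact ⟨Classical.arbitrary α, fun h => absurd h ht⟩
  choose y hy using hsurj'
  refine ⟨y, ⟨fun s hs t ht hst => ?_, fun t ht => ?_, fun t ht i hi => ?_⟩, ?_⟩
  · obtain ⟨h1, h2⟩ := hy s hs
    obtain ⟨h3, h4⟩ := hy t ht
    rw [← h2, ← h4]
    simp only [hst]
  · obtain ⟨h1, h2⟩ := hy t ht
    have := hA ⟨y t, h1⟩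
    rwa [h2] at this
  · obtain ⟨h1, h2⟩ := hy t ht
    exact mem_setSystemSupport.2 ⟨y t, h1, hi⟩
  · rintro _ ⟨t, ht, rfl⟩
    exact (hy t ht).1

/-- A Hall violator `W` must contain `x`, as `Z` is independent. Removing `x` leaves no room between
|W| - 1 and the support sizes, so `W.erase x` is tight with the same support as `W`, and that
contains `I` because of `x`. -/
theorem exists_isTightSystem_of_extension_dependent {α : Type*} {r : ℕ} {A : Fin r → Set α}
    {x : α} {I : Set (Fin r)} {Z : Set α} (hZ : IsPartialTransversal A Z)
    (h : ¬ IsPartialTransversal (extendSystem A x I) (insert x Z)) :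
    ∃ T y, IsTightSystem A T y ∧ y '' T ⊆ Z ∧ I ⊆ T := by
  classical
  have : Nonempty α := ⟨x⟩
  rw [isPartialTransversal_iff_hall] at h
  push Not at h
  obtain ⟨W, hW, hlt⟩ := h
  have hYZ : ((W.erase x : Finset α) : Set α) ⊆ Z := by
    intro e he
    rw [Finset.mem_coe, Finset.mem_erase] at he
    exact (hW he.2).resolve_left he.1
  have hY := hZ.subset hYZ
  have hYc := (isPartialTransversal_iff_hall A _).1 hY _ subset_rfl
  have hsub : setSystemSupport A (W.erase x) ⊆ setSystemSupport (extendSystem A x I) W := by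
    intro i hi
    obtain ⟨e, he, hi⟩ := mem_setSystemSupport.1 hi
    exact mem_setSystemSupport.2 ⟨e, Finset.mem_of_mem_erase he, Or.inl hi⟩
  have hle := Finset.card_le_card hsub
  have hxW : x ∈ W := by
    by_contra hx
    rw [Finset.erase_eq_of_notMem hx] at hYc hle
    omega
  have hc := Finset.card_erase_add_one hxW
  have heq := Finset.eq_of_subset_of_card_le hsub (by omega)
  obtain ⟨y, hy, hyY⟩ := exists_isTightSystem_of_card_eq hY (by omega)
  refine ⟨_, y, hy, hyY.trans hYZ, fun i hi => ?_⟩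
  rw [heq]
  exact mem_setSystemSupport.2 ⟨x, hxW, Or.inr ⟨rfl, hi⟩⟩

/-- The representatives together with `x` are |T| + 1 elements supported in `T`. -/
theorem IsTightSystem.extension_dependent {α : Type*} {r : ℕ} {A : Fin r → Set α}
    {x : α} {T I : Set (Fin r)} {y : Fin r → α} {Z : Set α} (hx : ∀ i, x ∉ A i)
    (hy : IsTightSystem A T y) (hyZ : y '' T ⊆ Z) (hI : I ⊆ T) :
    ¬ IsPartialTransversal (extendSystem A x I) (insert x Z) := by
  intro h
  have hxy : x ∉ y '' T := by
    rintro ⟨t, ht, rfl⟩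
    exact hx t (hy.mem t ht)
  have h1 := (h.subset (Set.insert_subset_insert hyZ)).encard_le_of_support (T := T) (by
    rintro e (rfl | ⟨t, ht, rfl⟩) i hi
    · rcases hi with hi | hi
      · exact absurd hi (hx i)
      · exact hI hi.2
    · exact (hy.extend hx I).support t ht i hi)
  rw [Set.encard_insert_of_notMem hxy, hy.injOn.encard_image] at h1
  exact absurd h1 (not_le.2 ((ENat.lt_add_one_iff (Set.toFinite _).encard_lt_top.ne).2 le_rfl))

/-! ### Coinciding extensions and counting -/

/-- Tight sets decide dependence, and those containing `I` are the same as those containing `insert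
j I`. -/
theorem transversalMatroid_extendSystem_insert {α : Type*} {r : ℕ} {A : Fin r → Set α}
    {x : α} {I : Set (Fin r)} {i j : Fin r} (E : Set α) (hx : ∀ i, x ∉ A i) (hi : i ∈ I)
    (hij : ∀ T y, IsTightSystem A T y → i ∈ T → j ∈ T) :
    transversalMatroid E (extendSystem A x (insert j I)) =
      transversalMatroid E (extendSystem A x I) := by
  refine Matroid.ext_indep rfl fun X _ => ?_
  rw [transversalMatroid_indep_iff, transversalMatroid_indep_iff]
  refine and_congr_right fun _ => ⟨fun h => ?_, fun h =>
    h.mono (extendSystem_mono A x (Set.subset_insert j I))⟩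
  by_cases hxX : x ∈ X
  · have hX : X = insert x (X \ {x}) := by simp [Set.insert_eq_of_mem hxX]
    have hxX' : x ∉ X \ {x} := by simp
    by_contra hcon
    rw [hX] at hcon
    obtain ⟨T, y, hy, hyX, hIT⟩ := exists_isTightSystem_of_extension_dependent
      ((isPartialTransversal_extendSystem_of_notMem hxX').1 (h.subset Set.sdiff_subset)) hcon
    refine hy.extension_dependent hx hyX
      (Set.insert_subset (hij T y hy (hIT hi)) hIT) ?_
    rwa [← hX]
  · rw [isPartialTransversal_extendSystem_of_notMem hxX] at h ⊢
    exact h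

theorem ncard_setOf_mem_imp_mem {r : ℕ} {i j : Fin r} (hij : i ≠ j) :
    4 * {I : Set (Fin r) | i ∈ I → j ∈ I}.ncard = 3 * 2 ^ r := by
  have hle : ({i, j} : Set (Fin r)).ncard = 2 := Set.ncard_pair hij
  have hc : ({i, j} : Set (Fin r))ᶜ.ncard + 2 = r := by
    have := Set.ncard_add_ncard_compl ({i, j} : Set (Fin r))
    rw [hle, Nat.card_eq_fintype_card, Fintype.card_fin] at this
    omega
  -- The excluded sets contain `i` but not `j`, so they are determined by their part outside `{i,
  -- j}`: a quarter of all sets.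
  have himg : {I : Set (Fin r) | i ∈ I → j ∈ I}ᶜ =
      (fun K => insert i K) '' 𝒫 ({i, j} : Set (Fin r))ᶜ := by
    ext I
    simp only [Set.mem_compl_iff, Set.mem_ofPred_eq, Classical.not_imp, Set.mem_image,
      Set.mem_powerset_iff]
    constructor
    · rintro ⟨h1, h2⟩
      refine ⟨I \ {i}, ?_, by simp [Set.insert_eq_of_mem h1]⟩
      rintro k ⟨hk, hki⟩ (rfl | rfl)
      · exact hki rfl
      · exact h2 hk
    · rintro ⟨K, hK, rfl⟩
      refine ⟨Set.mem_insert _ _, ?_⟩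
      rintro (h | h)
      · exact hij h.symm
      · exact hK h (Or.inr rfl)
  have hcompl : {I : Set (Fin r) | i ∈ I → j ∈ I}ᶜ.ncard =
      2 ^ ({i, j} : Set (Fin r))ᶜ.ncard := by
    rw [himg, Set.InjOn.ncard_image, Set.ncard_powerset]
    intro K hK L hL hKL
    have h1 : i ∉ K := fun h => hK h (Or.inl rfl)
    have h2 : i ∉ L := fun h => hL h (Or.inl rfl)
    have h3 : insert i K \ {i} = insert i L \ {i} := by
      simp only at hKL
      rw [hKL]
    simpa [Set.insert_sdiff_of_mem, h1, h2] using h3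
  have htot := Set.ncard_add_ncard_compl {I : Set (Fin r) | i ∈ I → j ∈ I}
  rw [hcompl, Nat.card_eq_fintype_card, Fintype.card_set, Fintype.card_fin] at htot
  have hpow : 2 ^ r = 2 ^ ({i, j} : Set (Fin r))ᶜ.ncard * 4 := by
    conv_lhs => rw [← hc]
    rw [pow_add]
    norm_num
  omega

theorem IsPresentation.isPartialTransversal_iff {α : Type*} {r : ℕ} {M : Matroid α}
    {A : Fin r → Set α} (hA : IsPresentation M A) {X : Set α} :
    IsPartialTransversal A X ↔ M.Indep X := by
  rw [← hA.eq_transversalMatroid, transversalMatroid_indep_iff]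
  refine ⟨fun h => ⟨fun e he => ?_, h⟩, fun h => h.2⟩
  obtain ⟨φ, -, hφ⟩ := h
  exact hA.subset_ground _ (hφ ⟨e, he⟩)

theorem four_mul_ncard_transversalExtensions_le {α : Type*} {r : ℕ} (M : Matroid α)
    {A : Fin r → Set α} {x : α} (hx : ∀ i, x ∉ A i) {i j : Fin r} (hne : i ≠ j)
    (hij : ∀ T y, IsTightSystem A T y → i ∈ T → j ∈ T) :
    4 * (transversalExtensions M A x).ncard ≤ 3 * 2 ^ r := by
  rw [← ncard_setOf_mem_imp_mem hne]
  refine Nat.mul_le_mul_left 4 ?_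
  have hsub : transversalExtensions M A x ⊆
      (fun I : Set (Fin r) => transversalMatroid (insert x M.E) (extendSystem A x I)) ''
        {I | i ∈ I → j ∈ I} := by
    rintro _ ⟨I, rfl⟩
    by_cases hi : i ∈ I
    · exact ⟨insert j I, fun _ => Set.mem_insert j I,
        transversalMatroid_extendSystem_insert _ hx hi hij⟩
    · exact ⟨I, fun h => absurd h hi, rfl⟩
  exact (Set.ncard_le_ncard hsub (Set.toFinite _)).trans (Set.ncard_image_le (Set.toFinite _))

/-! ### The upper bound -/

/-- Take `i ≠ j` outside the greatest tight subset of `{j}ᶜ`. A tight set containing `i` but not `j`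
would lie in that subset. -/
theorem exists_forall_mem_of_not_isTightSystem {α : Type*} [Nonempty α] {r : ℕ}
    (A : Fin r → Set α) {j : Fin r} (hj : ∀ y, ¬ IsTightSystem A {j}ᶜ y) :
    ∃ i ≠ j, ∀ T y, IsTightSystem A T y → i ∈ T → j ∈ T := by
  obtain ⟨T, y, hy, -, hTj, hmax⟩ := exists_greatest_isTightSystem A Set.univ {j}ᶜ
  have hne : ¬ ({j}ᶜ : Set (Fin r)) ⊆ T := fun h => hj y (hTj.antisymm h ▸ hy)
  obtain ⟨i, hij, hiT⟩ := Set.not_subset.1 hne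
  refine ⟨i, hij, fun U w hw hiU => ?_⟩
  by_contra hjU
  exact hiT (hmax U w hw (Set.subset_univ _) (fun k hk hkj => hjU (hkj ▸ hk)) hiU)

theorem exists_notMem_range_of_not_isReindexing {α : Type*} {r : ℕ} {A B : Fin r → Set α}
    (hAB : ¬ IsReindexing A B) (hB : Function.Injective B) : ∃ k, B k ∉ Set.range A := by
  by_contra! h
  choose τ hτ using h
  have hinj : Function.Injective τ := fun i j hij => hB (by rw [← hτ i, ← hτ j, hij])
  exact hAB ⟨Equiv.ofBijective τ (Finite.injective_iff_bijective.1 hinj), fun i => (hτ i).symm⟩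

theorem injective_of_forall_isTightSystem {α : Type*} {r : ℕ} {A : Fin r → Set α}
    (h : ∀ j, ∃ y, IsTightSystem A {j}ᶜ y) : Function.Injective A := by
  intro i j hij
  by_contra hne
  obtain ⟨y, hy⟩ := h j
  exact hy.support i hne j (hij ▸ hy.mem i hne) rfl

theorem ncard_compl_singleton_add_one {r : ℕ} (k : Fin r) :
    ({k}ᶜ : Set (Fin r)).ncard + 1 = r := by
  have := Set.ncard_add_ncard_compl ({k} : Set (Fin r))
  rw [Set.ncard_singleton, Nat.card_eq_fintype_card, Fintype.card_fin] at this
  omega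

theorem two_mul_ncard_setOf_mem {r : ℕ} (k : Fin r) :
    2 * {I : Set (Fin r) | k ∈ I}.ncard = 2 ^ r := by
  have h1 : {I : Set (Fin r) | k ∈ I}ᶜ = 𝒫 {k}ᶜ := by
    ext I
    simp [Set.mem_powerset_iff]
  have h2 := Set.ncard_add_ncard_compl {I : Set (Fin r) | k ∈ I}
  rw [h1, Set.ncard_powerset, Nat.card_eq_fintype_card, Fintype.card_set, Fintype.card_fin] at h2
  have h3 : 2 ^ r = 2 ^ ({k}ᶜ : Set (Fin r)).ncard * 2 := by
    conv_lhs => rw [← ncard_compl_singleton_add_one k]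
    rw [pow_succ]
  omega

/-- If |T| were r-1, `T` would be some `{j}ᶜ` with the same representatives as `{k}ᶜ`, and `mem_iff`
would give `A j = B k`. -/
theorem IsTightSystem.ncard_add_two_le {α : Type*} {r : ℕ} {M : Matroid α}
    {A B : Fin r → Set α} (hA : IsPresentation M A) (hB : IsPresentation M B) {k : Fin r}
    {y w : Fin r → α} (hy : IsTightSystem B {k}ᶜ y) (hk : B k ∉ Set.range A)
    {T : Set (Fin r)} (hw : IsTightSystem A T w) (hwy : w '' T ⊆ y '' {k}ᶜ) :
    T.ncard + 2 ≤ r := by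
  have hyc : (y '' {k}ᶜ).ncard + 1 = r := by
    rw [hy.injOn.ncard_image, ncard_compl_singleton_add_one]
  have hwc : (w '' T).ncard = T.ncard := hw.injOn.ncard_image
  have hle := Set.ncard_le_ncard hwy (Set.toFinite _)
  by_contra hcon
  have heq : w '' T = y '' {k}ᶜ := Set.eq_of_subset_of_ncard_le hwy (by omega) (Set.toFinite _)
  have hTc : Tᶜ.ncard = 1 := by
    have := Set.ncard_add_ncard_compl T
    rw [Nat.card_eq_fintype_card, Fintype.card_fin] at this
    omega
  obtain ⟨j, hj⟩ := Set.ncard_eq_one.1 hTc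
  obtain rfl : T = {j}ᶜ := by rw [← hj, compl_compl]
  refine hk ⟨j, Set.ext fun e => ?_⟩
  rw [hw.mem_iff, hy.mem_iff, heq, hA.isPartialTransversal_iff, hB.isPartialTransversal_iff]

theorem IsTightSystem.four_mul_ncard_inter_le {α : Type*} {r : ℕ} {M : Matroid α}
    {A B : Fin r → Set α} {x : α} (hx : x ∉ M.E) (hA : IsPresentation M A)
    (hB : IsPresentation M B) {k : Fin r} {y : Fin r → α} (hy : IsTightSystem B {k}ᶜ y)
    (hk : B k ∉ Set.range A) :
    4 * (transversalExtensions M A x ∩ transversalExtensions M B x).ncard ≤ 3 * 2 ^ r := by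
  have : Nonempty α := ⟨x⟩
  have hxA : ∀ i, x ∉ A i := fun i h => hx (hA.subset_ground i h)
  have hxB : ∀ i, x ∉ B i := fun i h => hx (hB.subset_ground i h)
  have hyE : y '' {k}ᶜ ⊆ M.E := by
    rintro _ ⟨t, ht, rfl⟩
    exact hB.subset_ground t (hy.mem t ht)
  obtain ⟨T, w, hw, hwy, -, hmax⟩ := exists_greatest_isTightSystem A (y '' {k}ᶜ) Set.univ
  have hT := hy.ncard_add_two_le hA hB hk hw hwy
  have hZA : IsPartialTransversal A (y '' {k}ᶜ) := by
    rw [hA.isPartialTransversal_iff, ← hB.isPartialTransversal_iff]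
    exact isPartialTransversal_image hy.mem
  have hsub : transversalExtensions M A x ∩ transversalExtensions M B x ⊆
      (fun I : Set (Fin r) => transversalMatroid (insert x M.E) (extendSystem A x I)) '' 𝒫 T ∪
      (fun I : Set (Fin r) => transversalMatroid (insert x M.E) (extendSystem B x I)) ''
        {I | k ∈ I} := by
    rintro N ⟨⟨I, hI⟩, ⟨J, hJ⟩⟩
    -- Independence of this set is read through `B`, where it forces `k ∈ J`; dependence is read
    -- through `A`, where it forces `I ⊆ T`.
    by_cases hN : N.Indep (insert x (y '' {k}ᶜ))
    · rw [← hJ, transversalMatroid_indep_iff, ← hy.extendSystem_mem_iff hxB] at hN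
      exact Or.inr ⟨J, hN.2, hJ⟩
    · rw [← hI, transversalMatroid_indep_iff,
        and_iff_right (Set.insert_subset_insert hyE)] at hN
      obtain ⟨U, v, hv, hvy, hIU⟩ := exists_isTightSystem_of_extension_dependent hZA hN
      exact Or.inl ⟨I, hIU.trans (hmax U v hv hvy (Set.subset_univ _)), hI⟩
  have h1 := (Set.ncard_le_ncard hsub (Set.toFinite _)).trans (Set.ncard_union_le _ _)
  have h2 := Set.ncard_image_le (f := fun I : Set (Fin r) =>
    transversalMatroid (insert x M.E) (extendSystem A x I)) (Set.toFinite (𝒫 T))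
  have h3 := Set.ncard_image_le (f := fun I : Set (Fin r) =>
    transversalMatroid (insert x M.E) (extendSystem B x I)) (Set.toFinite {I | k ∈ I})
  rw [Set.ncard_powerset] at h2
  have h4 := two_mul_ncard_setOf_mem k
  have h5 : 4 * 2 ^ T.ncard ≤ 2 ^ r := by
    have := Nat.pow_le_pow_right (n := 2) (by norm_num) hT
    rw [pow_add] at this
    omega
  omega

theorem four_mul_ncard_transversalExtensions_inter_le {α : Type*} {r : ℕ} {M : Matroid α}
    {A B : Fin r → Set α} {x : α} (hx : x ∉ M.E) (hA : IsPresentation M A)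
    (hB : IsPresentation M B) (hAB : ¬ IsReindexing A B) :
    4 * (transversalExtensions M A x ∩ transversalExtensions M B x).ncard ≤ 3 * 2 ^ r := by
  have : Nonempty α := ⟨x⟩
  by_cases h : ∀ j, ∃ y, IsTightSystem B {j}ᶜ y
  · obtain ⟨k, hk⟩ := exists_notMem_range_of_not_isReindexing hAB
      (injective_of_forall_isTightSystem h)
    obtain ⟨y, hy⟩ := h k
    exact hy.four_mul_ncard_inter_le hx hA hB hk
  · push Not at h
    obtain ⟨j, hj⟩ := h
    obtain ⟨i, hij, hi⟩ := exists_forall_mem_of_not_isTightSystem B hj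
    exact (Nat.mul_le_mul_left 4 (Set.ncard_le_ncard Set.inter_subset_right
      (transversalExtensions_finite M B x))).trans
      (four_mul_ncard_transversalExtensions_le M (fun i h => hx (hB.subset_ground i h)) hij hi)

/-! ### Sharpness: coloops and a triangle -/

/-- The set system whose `i`-th set is `{z i}`, except that the sets with index `p` or `q` also
contain `a`. -/
def coloopTriangleSystem {α : Type*} {r : ℕ} (z : Fin r → α) (a : α) (p q : Fin r) :
    Fin r → Set α :=
  fun i => {e | e = z i ∨ (e = a ∧ (i = p ∨ i = q))}

section

variable {α : Type*} {r : ℕ} {z : Fin r → α} {a : α} {p q : Fin r}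

theorem apply_mem_coloopTriangleSystem_iff (hz : Function.Injective z) (ha : a ∉ Set.range z)
    {i j : Fin r} : z i ∈ coloopTriangleSystem z a p q j ↔ i = j := by
  constructor
  · rintro (h | h)
    · exact hz h
    · exact absurd ⟨i, h.1⟩ ha
  · rintro rfl
    exact Or.inl rfl

theorem isTightSystem_coloopTriangleSystem (hz : Function.Injective z) (ha : a ∉ Set.range z)
    (T : Set (Fin r)) : IsTightSystem (coloopTriangleSystem z a p q) T z :=
  ⟨hz.injOn, fun _ _ => Or.inl rfl, fun _ ht _ hi =>
    (apply_mem_coloopTriangleSystem_iff hz ha).1 hi ▸ ht⟩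

theorem isPartialTransversal_coloopTriangleSystem_iff (hz : Function.Injective z)
    (ha : a ∉ Set.range z) (hpq : p ≠ q) {X : Set α} (hX : X ⊆ insert a (Set.range z)) :
    IsPartialTransversal (coloopTriangleSystem z a p q) X ↔
      (X ∩ {a, z p, z q}).encard ≤ 2 := by
  classical
  constructor
  · intro h
    have h1 := (h.subset (Set.inter_subset_left (t := {a, z p, z q}))).encard_le_of_support
      (T := {p, q}) (by
        rintro e ⟨-, he⟩ i hi
        rcases he with rfl | rfl | rfl
        · rcases hi with hi | hi
          · exact absurd ⟨i, hi.symm⟩ ha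
          · exact hi.2
        · exact Or.inl ((apply_mem_coloopTriangleSystem_iff hz ha).1 hi).symm
        · exact Or.inr ((apply_mem_coloopTriangleSystem_iff hz ha).1 hi).symm)
    rwa [Set.encard_pair hpq] at h1
  · intro h
    -- If `z p` or `z q` is missing from `X`, its index is free for `a`.
    have key : ∀ s : Fin r, s = p ∨ s = q → z s ∉ X →
        IsPartialTransversal (coloopTriangleSystem z a p q) X := by
      intro s hs hsX
      refine (isPartialTransversal_image (y := Function.update z s a) (T := Set.univ)
        fun t _ => ?_).subset fun e he => ?_
      · by_cases hts : t = s
        · subst hts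
          rw [Function.update_self]
          exact Or.inr ⟨rfl, hs⟩
        · rw [Function.update_of_ne hts]
          exact Or.inl rfl
      · rcases hX he with rfl | ⟨t, rfl⟩
        · exact ⟨s, trivial, Function.update_self _ _ _⟩
        · refine ⟨t, trivial, Function.update_of_ne ?_ _ _⟩
          rintro rfl
          exact hsX he
    by_cases haX : a ∈ X
    · by_cases hp : z p ∈ X
      · refine key q (Or.inr rfl) fun hq => ?_
        have h1 : X ∩ {a, z p, z q} = {a, z p, z q} := by
          refine Set.inter_eq_right.2 ?_
          rintro e (rfl | rfl | rfl) <;> assumption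
        rw [h1, Set.encard_insert_of_notMem, Set.encard_pair (hz.ne hpq)] at h
        · exact absurd h (by decide)
        · rintro (h | h)
          · exact ha ⟨p, h.symm⟩
          · exact ha ⟨q, h.symm⟩
      · exact key p (Or.inl rfl) hp
    · refine (isPartialTransversal_image (y := z) (T := Set.univ)
        fun t _ => Or.inl rfl).subset fun e he => ?_
      rcases hX he with rfl | ⟨t, rfl⟩
      · exact absurd he haX
      · exact ⟨t, trivial, rfl⟩

theorem injective_update (hz : Function.Injective z) (ha : a ∉ Set.range z) :
    Function.Injective (Function.update z p a) := by
  intro i j h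
  by_cases hi : i = p <;> by_cases hj : j = p
  · rw [hi, hj]
  · subst hi
    rw [Function.update_self, Function.update_of_ne hj] at h
    exact absurd ⟨j, h.symm⟩ ha
  · subst hj
    rw [Function.update_self, Function.update_of_ne hi] at h
    exact absurd ⟨i, h⟩ ha
  · rw [Function.update_of_ne hi, Function.update_of_ne hj] at h
    exact hz h

theorem apply_notMem_range_update (hz : Function.Injective z) (ha : a ∉ Set.range z) :
    z p ∉ Set.range (Function.update z p a) := by
  rintro ⟨i, hi⟩
  by_cases hip : i = p
  · subst hip
    rw [Function.update_self] at hi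
    exact ha ⟨i, hi.symm⟩
  · rw [Function.update_of_ne hip] at hi
    exact hip (hz hi)

theorem insert_range_update :
    insert (z p) (Set.range (Function.update z p a)) = insert a (Set.range z) := by
  ext e
  constructor
  · rintro (rfl | ⟨i, rfl⟩)
    · exact Or.inr ⟨p, rfl⟩
    · by_cases hip : i = p
      · subst hip
        rw [Function.update_self]
        exact Or.inl rfl
      · rw [Function.update_of_ne hip]
        exact Or.inr ⟨i, rfl⟩
  · rintro (rfl | ⟨i, rfl⟩)
    · exact Or.inr ⟨p, Function.update_self _ _ _⟩
    · by_cases hip : i = p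
      · subst hip
        exact Or.inl rfl
      · exact Or.inr ⟨i, Function.update_of_ne hip _ _⟩

/-- In the second system `z p` and `z q` share a set; in the first each `z i` lies in set `i` only.
-/
theorem not_isReindexing_coloopTriangleSystem (hz : Function.Injective z)
    (ha : a ∉ Set.range z) (hpq : p ≠ q) :
    ¬ IsReindexing (coloopTriangleSystem z a p q)
      (coloopTriangleSystem (Function.update z p a) (z p) p q) := by
  rintro ⟨τ, hτ⟩
  have h1 : z q ∈ coloopTriangleSystem (Function.update z p a) (z p) p q q :=
    Or.inl (Function.update_of_ne hpq.symm _ _).symm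
  have h2 : z p ∈ coloopTriangleSystem (Function.update z p a) (z p) p q q :=
    Or.inr ⟨rfl, Or.inr rfl⟩
  rw [hτ, apply_mem_coloopTriangleSystem_iff hz ha] at h1 h2
  exact hpq (h2.trans h1.symm)

/-- The matching survives unless it sends `a` to `q`. In that case interchanging `p` and `q` repairs
it: `a` moves to `p`, and `z p` or `x` may move from `p` to `q`. -/
theorem IsPartialTransversal.extendSystem_swap {x : α} {I : Set (Fin r)} {X : Set α}
    (hI : p ∈ I → q ∈ I)
    (hX : IsPartialTransversal (extendSystem (coloopTriangleSystem z a p q) x I) X) :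
    IsPartialTransversal
      (extendSystem (coloopTriangleSystem (Function.update z p a) (z p) p q) x I) X := by
  obtain ⟨φ, hφ, hA⟩ := hX
  by_cases haX : ∃ f : X, (f : α) = a ∧ φ f = q
  · obtain ⟨f, hfa, hfq⟩ := haX
    refine ⟨fun e => Equiv.swap p q (φ e), (Equiv.injective _).comp hφ, fun e => ?_⟩
    by_cases hef : e = f
    · subst hef
      simp only [hfq, Equiv.swap_apply_right]
      exact Or.inl (Or.inl (by rw [hfa, Function.update_self]))
    · have hq : φ e ≠ q := fun h => hef (hφ (h.trans hfq.symm))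
      by_cases hp : φ e = p
      · have h := hA e
        simp only [hp, Equiv.swap_apply_left] at h ⊢
        rcases h with (h | h) | h
        · exact Or.inl (Or.inr ⟨h, Or.inr rfl⟩)
        · exact absurd (Subtype.ext (h.1.trans hfa.symm)) hef
        -- Here `x` moves from `p` to `q`; this is what `hI` is needed for.
        · exact Or.inr ⟨h.1, hI h.2⟩
      · simp only [Equiv.swap_apply_of_ne_of_ne hp hq]
        rcases hA e with (h | h) | h
        · exact Or.inl (Or.inl (by rw [Function.update_of_ne hp, h]))
        · exact absurd h.2 (not_or.2 ⟨hp, hq⟩)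
        · exact Or.inr h
  · push Not at haX
    refine ⟨φ, hφ, fun e => ?_⟩
    rcases hA e with (h | h) | h
    · by_cases hp : φ e = p
      · rw [hp] at h ⊢
        exact Or.inl (Or.inr ⟨h, Or.inl rfl⟩)
      · exact Or.inl (Or.inl (by rw [Function.update_of_ne hp, h]))
    · have hp := h.2.resolve_right (haX e h.1)
      rw [hp]
      exact Or.inl (Or.inl (by rw [Function.update_self, h.1]))
    · exact Or.inr h

theorem transversalMatroid_extendSystem_swap {x : α} {I : Set (Fin r)} (E : Set α)
    (hI : p ∈ I → q ∈ I) :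
    transversalMatroid E (extendSystem (coloopTriangleSystem z a p q) x I) =
      transversalMatroid E
        (extendSystem (coloopTriangleSystem (Function.update z p a) (z p) p q) x I) := by
  refine Matroid.ext_indep rfl fun X _ => ?_
  rw [transversalMatroid_indep_iff, transversalMatroid_indep_iff]
  refine and_congr_right fun _ => ⟨fun h => h.extendSystem_swap hI, fun h => ?_⟩
  -- Exchanging `a` and `z p` is an involution, so the same implication gives the converse.
  have h1 := h.extendSystem_swap hI
  rwa [Function.update_self, Function.update_idem, Function.update_eq_self] at h1

/-- When all `{j}ᶜ` are tight, each membership `j ∈ I` can be read off the extension. -/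
theorem injective_transversalMatroid_extendSystem {A : Fin r → Set α} {x : α} {E : Set α}
    (hAE : ∀ i, A i ⊆ E) (hx : x ∉ E) (h : ∀ j, ∃ y, IsTightSystem A {j}ᶜ y) :
    Function.Injective fun I : Set (Fin r) =>
      transversalMatroid (insert x E) (extendSystem A x I) := by
  intro I J hIJ
  ext j
  obtain ⟨y, hy⟩ := h j
  have hxA : ∀ i, x ∉ A i := fun i hi => hx (hAE i hi)
  have hyE : insert x (y '' {j}ᶜ) ⊆ insert x E := by
    refine Set.insert_subset_insert ?_
    rintro _ ⟨t, ht, rfl⟩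
    exact hAE t (hy.mem t ht)
  have h1 := congrArg (fun N : Matroid α => N.Indep (insert x (y '' {j}ᶜ))) hIJ
  simp only [transversalMatroid_indep_iff, hyE, true_and, eq_iff_iff] at h1
  rw [hy.extendSystem_mem_iff hxA, hy.extendSystem_mem_iff hxA, h1]

theorem isPresentation_coloopTriangleSystem {M : Matroid α} (hz : Function.Injective z)
    (ha : a ∉ Set.range z) (hpq : p ≠ q) (hE : M.E = insert a (Set.range z))
    (hM : ∀ X ⊆ M.E, M.Indep X ↔ (X ∩ {a, z p, z q}).encard ≤ 2) :
    IsPresentation M (coloopTriangleSystem z a p q) := by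
  have hsub : ∀ i, coloopTriangleSystem z a p q i ⊆ M.E := by
    rintro i e (rfl | ⟨rfl, -⟩)
    · exact hE ▸ Or.inr ⟨i, rfl⟩
    · exact hE ▸ Or.inl rfl
  have heq : transversalMatroid M.E (coloopTriangleSystem z a p q) = M := by
    refine Matroid.ext_indep rfl fun X hX => ?_
    rw [transversalMatroid_ground] at hX
    rw [transversalMatroid_indep_iff, and_iff_right hX, hM X hX,
      isPartialTransversal_coloopTriangleSystem_iff hz ha hpq (hE ▸ hX)]
  refine ⟨le_antisymm ?_ ?_, hsub, heq⟩
  · obtain ⟨B, hB⟩ := M.exists_isBase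
    have h := hB.indep
    rw [← heq, transversalMatroid_indep_iff] at h
    exact hB.encard_eq_eRank ▸ h.2.encard_le
  · have h : M.Indep (Set.range z) := by
      rw [← heq, transversalMatroid_indep_iff, ← Set.image_univ]
      exact ⟨by rw [Set.image_univ, hE]; exact Set.subset_insert _ _,
        isPartialTransversal_image fun t _ => Or.inl rfl⟩
    have h1 := h.encard_le_eRank
    rw [← Set.image_univ, hz.injOn.encard_image, Set.encard_univ] at h1
    simpa using h1

theorem three_mul_le_four_mul_ncard_coloopTriangleSystem {M : Matroid α} {x : α}
    (hz : Function.Injective z) (ha : a ∉ Set.range z) (hpq : p ≠ q)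
    (hA : IsPresentation M (coloopTriangleSystem z a p q)) (hx : x ∉ M.E) :
    3 * 2 ^ r ≤ 4 * (transversalExtensions M (coloopTriangleSystem z a p q) x ∩
      transversalExtensions M
        (coloopTriangleSystem (Function.update z p a) (z p) p q) x).ncard := by
  have hinj := injective_transversalMatroid_extendSystem hA.subset_ground hx
    fun j => ⟨z, isTightSystem_coloopTriangleSystem hz ha _⟩
  rw [← ncard_setOf_mem_imp_mem hpq, ← hinj.injOn.ncard_image]
  refine Nat.mul_le_mul_left 4 (Set.ncard_le_ncard ?_
    ((transversalExtensions_finite M _ x).inter_of_left _))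
  rintro _ ⟨I, hI, rfl⟩
  exact ⟨⟨I, rfl⟩, ⟨I, (transversalMatroid_extendSystem_swap _ hI).symm⟩⟩

theorem exists_enumeration {S D : Set α} (hr : 2 ≤ r) (hSD : Disjoint S D)
    (hS : S.encard = ((r - 2 : ℕ) : ℕ∞)) (hD : D.encard = 3) :
    ∃ (z : Fin r → α) (a : α) (p q : Fin r), Function.Injective z ∧ a ∉ Set.range z ∧ p ≠ q ∧
      S ∪ D = insert a (Set.range z) ∧ D = {a, z p, z q} := by
  -- One triangle element is set aside as `a`; the other two and the r-2 coloops are enumerated by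
  -- `z`.
  obtain ⟨a, b, c, hab, hac, hbc, rfl⟩ := Set.encard_eq_three.1 hD
  have hdis : Disjoint S {b, c} := hSD.mono_right (Set.subset_insert _ _)
  have hcard : (S ∪ {b, c}).encard = r := by
    rw [Set.encard_union_eq hdis, hS, Set.encard_pair hbc]
    exact_mod_cast Nat.sub_add_cancel hr
  have hfin : (S ∪ {b, c}).Finite := Set.finite_of_encard_eq_coe hcard
  have hn : Nat.card ↥(S ∪ {b, c}) = r := by
    rw [Nat.card_coe_set_eq, Set.ncard, hcard, ENat.toNat_natCast]
  have : Finite ↥(S ∪ {b, c}) := hfin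
  obtain ⟨e⟩ : Nonempty (↥(S ∪ {b, c}) ≃ Fin r) := ⟨Finite.equivFinOfCardEq hn⟩
  have hrange : Set.range (fun i => (e.symm i : α)) = S ∪ {b, c} := by
    ext f
    exact ⟨by rintro ⟨i, rfl⟩; exact (e.symm i).2, fun hf => ⟨e ⟨f, hf⟩, by simp⟩⟩
  refine ⟨fun i => e.symm i, a, e ⟨b, by simp⟩, e ⟨c, by simp⟩,
    Subtype.val_injective.comp e.symm.injective, ?_, ?_, ?_, by simp⟩
  · rw [hrange]
    rintro (h | h | h)
    · exact Set.disjoint_left.1 hSD h (Or.inl rfl)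
    · exact hab h
    · exact hac h
  · exact fun h => hbc (congrArg Subtype.val (e.injective h))
  · rw [hrange, Set.union_insert]

end

/-! ### The direct sum and the main theorem -/

theorem disjointSum_uniformMatroid_indep_iff {α : Type*} {S D : Set α} {k l : ℕ}
    (hSD : Disjoint S D) (hS : S.encard = k) {X : Set α} (hX : X ⊆ S ∪ D) :
    ((uniformMatroid S k).disjointSum (uniformMatroid D l) hSD).Indep X ↔
      (X ∩ D).encard ≤ l := by
  refine (Matroid.disjointSum_indep_iff (M := uniformMatroid S k) (N := uniformMatroid D l)
    (h := hSD)).trans ⟨fun h => h.2.1.2, fun h => ⟨⟨Set.inter_subset_right, ?_⟩,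
    ⟨Set.inter_subset_right, h⟩, hX⟩⟩
  exact hS ▸ Set.encard_le_encard Set.inter_subset_right

theorem mainTheorem6 {α : Type*} (r : ℕ) (x : α) :
    (∀ (M : Matroid α) [M.Finite] (A B : Fin r → Set α),
      x ∉ M.E → IsPresentation M A → IsPresentation M B → ¬ IsReindexing A B →
        ((transversalExtensions M A x ∩ transversalExtensions M B x).ncard : ℝ)
          ≤ 3 / 4 * 2 ^ r) ∧
    (2 ≤ r → ∀ (S D : Set α) (hSD : Disjoint S D), x ∉ S ∪ D →
      S.encard = ((r - 2 : ℕ) : ℕ∞) → D.encard = 3 →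
        ∃ A B : Fin r → Set α,
          IsPresentation ((uniformMatroid S (r - 2)).disjointSum (uniformMatroid D 2) hSD) A ∧
          IsPresentation ((uniformMatroid S (r - 2)).disjointSum (uniformMatroid D 2) hSD) B ∧
          ¬ IsReindexing A B ∧
          ((transversalExtensions
              ((uniformMatroid S (r - 2)).disjointSum (uniformMatroid D 2) hSD) A x ∩
            transversalExtensions
              ((uniformMatroid S (r - 2)).disjointSum (uniformMatroid D 2) hSD) B x).ncard : ℝ)
            = 3 / 4 * 2 ^ r) := by
  refine ⟨fun M _ A B hx hA hB hAB => ?_, fun hr S D hSD hx hS hD => ?_⟩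
  · have h := four_mul_ncard_transversalExtensions_inter_le hx hA hB hAB
    have h1 : (4 * ((transversalExtensions M A x ∩ transversalExtensions M B x).ncard : ℝ)) ≤
        3 * 2 ^ r := by exact_mod_cast h
    linarith
  · obtain ⟨z, a, p, q, hz, ha, hpq, hE, rfl⟩ := exists_enumeration hr hSD hS hD
    set M := (uniformMatroid S (r - 2)).disjointSum (uniformMatroid {a, z p, z q} 2) hSD with hM
    have hME : M.E = S ∪ {a, z p, z q} := Matroid.disjointSum_ground_eq
    have hindep : ∀ X ⊆ M.E, M.Indep X ↔ (X ∩ {a, z p, z q}).encard ≤ 2 := fun X hX =>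
      disjointSum_uniformMatroid_indep_iff hSD hS (hME ▸ hX)
    have hA := isPresentation_coloopTriangleSystem hz ha hpq (hME.trans hE) hindep
    have hB : IsPresentation M (coloopTriangleSystem (Function.update z p a) (z p) p q) := by
      refine isPresentation_coloopTriangleSystem (injective_update hz ha)
        (apply_notMem_range_update hz ha) hpq
        ((hME.trans hE).trans insert_range_update.symm) fun X hX => ?_
      -- Exchanging `a` and `z p` leaves the triangle unchanged as a set, so the same criterion
      -- presents `M` by the second system.
      rw [hindep X hX, Function.update_self, Function.update_of_ne hpq.symm, Set.insert_comm]
    have hAB := not_isReindexing_coloopTriangleSystem hz ha hpq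
    have hxM : x ∉ M.E := hME ▸ hx
    refine ⟨_, _, hA, hB, hAB, ?_⟩
    have h := (four_mul_ncard_transversalExtensions_inter_le hxM hA hB hAB).antisymm
      (three_mul_le_four_mul_ncard_coloopTriangleSystem hz ha hpq hA hxM)
    have h1 : (4 * ((transversalExtensions M (coloopTriangleSystem z a p q) x ∩
        transversalExtensions M
          (coloopTriangleSystem (Function.update z p a) (z p) p q) x).ncard : ℝ)) =
        3 * 2 ^ r := by exact_mod_cast h
    linarith
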